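/- Let $d\ge 1$ be an integer. Write $|\cdot|$ for the Euclidean norm on $\mathbb R^d$, $B(x,r)$ for the open ball with center $x$ and radius $r$, $\mathcal H_d$ for Lebesgue measure on $\mathbb R^d$, and $V_d$ for the volume of the unit ball of $\mathbb R^d$. * For a family $\mathcal B$ of unit balls in $\mathbb R^d$ its density is $\Delta(\mathcal B)=\lim_{R\to\infty}(2R)^{-d}\sum_{B\in\mathcal B}\mathcal H_d(B\cap[-R,R]^d)$, whenever this limit exists. The optimal covering density is $\Gamma_d=\inf\Delta(\mathcal B)$, the infimum being over all families $\mathcal B$ of unit balls that cover $\mathbb R^d$ and have a density. * For a nonempty compact set $A\subset\mathbb R^d$ and $r>0$, $N_A(r)$ is the least $N$ such that $A\subset\bigcup_{j=1}^N B(x_j,r)$ for some $x_1,\dots,x_N\in A$. * For $N\ge1$, $\rho_A(N)=\min_{x_1,\dots,x_N\in A}\ \max_{y\in A}\ \min_{1\le j\le N}|y-x_j|$. * For $s>0$, $\mathcal P_s(A;N)=\sup_{x_1,\dots,x_N\in A}\ \inf_{y\in A}\sum_{j=1}^N|y-x_j|^{-s}$ (with $|y-x_j|^{-s}=+\infty$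 if $y=x_j$), and for $s>d$, $\sigma_{s,d}=\lim_{N\to\infty}\mathcal P_s([0,1]^d;N)/N^{s/d}$. Then $0<\Gamma_d<\infty$; for every $s>d$ the limit $\sigma_{s,d}$ exists and $0<\sigma_{s,d}<\infty$; and all the limits below exist and satisfy $$\frac{\Gamma_d}{V_d}=\lim_{R\to\infty}\frac{N_{[-R,R]^d}(1)}{(2R)^d}=\lim_{r\to0^+}r^dN_{[0,1]^d}(r)=\lim_{N\to\infty}N\,\rho_{[0,1]^d}(N)^d=\lim_{s\to\infty}\sigma_{s,d}^{-d/s}.$$ -/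

import Mathlib

open Filter Topology MeasureTheory
open scoped ENNReal

namespace RieszCovering

noncomputable section

/-- The cube `[a, b]^d` in the Euclidean space `ℝ^d`. -/
def cube (d : ℕ) (a b : ℝ) : Set (EuclideanSpace ℝ (Fin d)) :=
  {x | ∀ i, x i ∈ Set.Icc a b}

/-- `P_s(A; ω) = inf_{y ∈ A} ∑_j |y - x_j|^{-s}` for the `N`-point configuration
`ω = (x_1, …, x_N)` in `A` (repetitions allowed). The sum is taken in `[0, ∞]`, so that
(for `s > 0`) the potential is `∞` at the points of the configuration. -/
def configPolarization {E : Type*} [MetricSpace E] (s : ℝ) (A : Set E) {N : ℕ}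
    (x : Fin N → A) : ℝ≥0∞ :=
  ⨅ y : A, ∑ j, 1 / edist (y : E) (x j : E) ^ s

/-- The `N`-th `s`-polarization constant `𝒫_s(A; N) = sup_{ω_N ⊂ A} P_s(A; ω_N)`. -/
def polarization {E : Type*} [MetricSpace E] (s : ℝ) (A : Set E) (N : ℕ) : ℝ≥0∞ :=
  ⨆ x : Fin N → A, configPolarization s A x

/-- The constant `σ_{s,d} = lim_{N → ∞} 𝒫_s([0,1]^d; N) / N^{s/d}`. -/
def sigma (s : ℝ) (d : ℕ) : ℝ≥0∞ :=
  limUnder atTop fun N : ℕ => polarization s (cube d 0 1) N / (N : ℝ≥0∞) ^ (s / (d : ℝ))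

/-- The covering radius `ρ_A(ω) = max_{y ∈ A} min_{x ∈ ω} |y - x|` of a configuration in `A`. -/
def configCoveringRadius {E : Type*} [MetricSpace E] (A : Set E) {N : ℕ} (x : Fin N → A) : ℝ :=
  ⨆ y : A, ⨅ j, dist (y : E) (x j : E)

/-- The best `N`-point covering radius `ρ_A(N) = min_{ω_N ⊂ A} ρ_A(ω_N)`. -/
def coveringRadius {E : Type*} [MetricSpace E] (A : Set E) (N : ℕ) : ℝ :=
  ⨅ x : Fin N → A, configCoveringRadius A x

/-- `N_A(r)`: the least number of open balls of radius `r` centered in `A` that cover `A`. -/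
def coveringCount {E : Type*} [MetricSpace E] (A : Set E) (r : ℝ) : ℕ :=
  sInf {N : ℕ | ∃ x : Fin N → E, (∀ j, x j ∈ A) ∧ A ⊆ ⋃ j, Metric.ball (x j) r}

/-- The family `{B(c, 1) : c ∈ C}` of unit balls has density
`D = lim_{R → ∞} (∑_{c ∈ C} vol (B(c,1) ∩ [-R,R]^d)) / (2R)^d`; in particular the limit exists. -/
def HasDensity {d : ℕ} (C : Set (EuclideanSpace ℝ (Fin d))) (D : ℝ≥0∞) : Prop :=
  Tendsto
    (fun R : ℝ =>
      (∑' c : C, volume (Metric.ball (c : EuclideanSpace ℝ (Fin d)) 1 ∩ cube d (-R) R)) /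
        ENNReal.ofReal ((2 * R) ^ d))
    atTop (𝓝 D)

/-- The optimal covering density `Γ_d` of `ℝ^d`: the infimum of the densities of all families of
unit balls that cover `ℝ^d` and have a density. -/
def optimalCoveringDensity (d : ℕ) : ℝ≥0∞ :=
  sInf {D : ℝ≥0∞ | ∃ C : Set (EuclideanSpace ℝ (Fin d)),
    (⋃ c ∈ C, Metric.ball c 1) = Set.univ ∧ HasDensity C D}

/-- The volume `V_d` of the closed unit ball of `ℝ^d`. -/
def unitBallVolume (d : ℕ) : ℝ≥0∞ :=
  volume (Metric.closedBall (0 : EuclideanSpace ℝ (Fin d)) 1)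

end

end RieszCovering

namespace RieszCovering

variable {d : ℕ}

/-! Everything is compared with one number θ, the infimum over r > 0 of r^d N(r), where N(r) is the
covering number of the unit cube. Tiling the cube by k^d shrunken copies gives N(r/k) ≤ k^d N(r), so
r^d N(r) tends to θ. The cubes [-R,R]^d follow by scaling, and the covering radius is essentially
the inverse function of N.

Density: in any covering, the balls meeting a slightly smaller cube cover it and lie in the large
cube, so the density is at least θ V_d. Repeating an economical cover of [0,L]^d along Lℤ^d gives
densities arbitrarily close to θ V_d (`optimalCoveringDensity_eq`).

Polarization: the same tiling gives k^s 𝒫_s(N) ≤ 𝒫_s(k^d N), so σ is the supremum of the normalized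
values. An optimal cover yields σ ≥ (r^d N(r))^(-s/d) (`le_sigma`). For the reverse bound fix q < θ
and put r = (q/N)^(1/d). The r-balls about N given points, with a small fraction of further balls
covering all places where the points crowd, are too few to cover the cube. Hence some y is at
distance at least r from every point and uncrowded, with potential at most K r^(-s), K independent
of s and N (`exists_polarization_le`). The power -d/s removes K as s → ∞. -/

lemma cube_nonempty {a b : ℝ} (h : a ≤ b) : (cube d a b).Nonempty :=
  ⟨WithLp.toLp 2 fun _ => a, fun _ => ⟨le_rfl, h⟩⟩

lemma cube_eq_preimage (a b : ℝ) :
    cube d a b = (EuclideanSpace.equiv (Fin d) ℝ) ⁻¹' (Set.Icc (fun _ => a) fun _ => b) := by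
  ext x
  simp [cube, Pi.le_def, forall_and]

lemma isCompact_cube (a b : ℝ) : IsCompact (cube d a b) := by
  rw [cube_eq_preimage]
  exact (EuclideanSpace.equiv (Fin d) ℝ).toHomeomorph.isCompact_preimage.2 isCompact_Icc

lemma volume_cube (a b : ℝ) : volume (cube d a b) = ENNReal.ofReal (b - a) ^ d := by
  rw [cube_eq_preimage]
  have := (PiLp.volume_preserving_ofLp (Fin d)).measure_preimage
    (measurableSet_Icc (a := fun _ : Fin d => a) (b := fun _ => b)).nullMeasurableSet
  refine this.trans ?_
  rw [Real.volume_Icc_pi]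
  simp

/-- Every point can be projected to a cube so that no distance to a point of the cube increases. -/
lemma exists_clamp {a b : ℝ} (h : a ≤ b) (x : EuclideanSpace ℝ (Fin d)) :
    ∃ x' ∈ cube d a b, ∀ y ∈ cube d a b, dist y x' ≤ dist y x := by
  refine ⟨WithLp.toLp 2 fun i => max a (min b (x i)), fun i => ⟨le_max_left _ _,
    max_le h (min_le_left _ _)⟩, fun y hy => ?_⟩
  rw [EuclideanSpace.dist_eq, EuclideanSpace.dist_eq]
  refine Real.sqrt_le_sqrt (Finset.sum_le_sum fun i _ => pow_le_pow_left₀ dist_nonneg ?_ 2)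
  obtain ⟨h1, h2⟩ := hy i
  simp only [Real.dist_eq]
  rcases le_total b (x i) with h3 | h3
  · rw [min_eq_left h3, max_eq_right h, abs_sub_comm, abs_of_nonneg (by linarith),
      abs_sub_comm, abs_of_nonneg (by linarith)]
    linarith
  · rw [min_eq_right h3]
    rcases le_total a (x i) with h4 | h4
    · rw [max_eq_right h4]
    · rw [max_eq_left h4, abs_of_nonneg (by linarith), abs_of_nonneg (by linarith)]
      linarith

/-! ### Covering numbers with unrestricted centers -/

/-- Clamping moves centers into the cube without losing coverage, so later arguments may place them
anywhere. -/
lemma coveringCount_le_card {a b r : ℝ} (h : a ≤ b) (S : Finset (EuclideanSpace ℝ (Fin d)))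
    (hS : ∀ y ∈ cube d a b, ∃ x ∈ S, dist y x < r) :
    coveringCount (cube d a b) r ≤ S.card := by
  choose p hp hp' using exists_clamp (d := d) h
  refine Nat.sInf_le ⟨fun j => p (S.equivFin.symm j), fun j => hp _, fun y hy => ?_⟩
  obtain ⟨x, hx, hxy⟩ := hS y hy
  refine Set.mem_iUnion.2 ⟨S.equivFin ⟨x, hx⟩, ?_⟩
  simpa using (hp' x y hy).trans_lt hxy

lemma exists_cover {E : Type*} [MetricSpace E] {A : Set E} (hA : IsCompact A) {r : ℝ}
    (hr : 0 < r) :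
    ∃ x : Fin (coveringCount A r) → E, (∀ j, x j ∈ A) ∧ A ⊆ ⋃ j, Metric.ball (x j) r := by
  refine Nat.sInf_mem (s := {N : ℕ | ∃ x : Fin N → E, (∀ j, x j ∈ A) ∧
    A ⊆ ⋃ j, Metric.ball (x j) r}) ?_
  obtain ⟨t, htA, ht, hc⟩ := hA.finite_cover_balls hr
  refine ⟨ht.toFinset.card, fun j => ht.toFinset.equivFin.symm j, fun j => htA ?_, fun y hy => ?_⟩
  · exact ht.mem_toFinset.1 (ht.toFinset.equivFin.symm j).2
  · obtain ⟨x, hx, hxy⟩ := Set.mem_iUnion₂.1 (hc hy)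
    refine Set.mem_iUnion.2 ⟨ht.toFinset.equivFin ⟨x, ht.mem_toFinset.2 hx⟩, ?_⟩
    simpa using hxy

/-- A covering configuration with any number `N ≥ N_A(r)` of points. -/
lemma exists_config {E : Type*} [MetricSpace E] {A : Set E} (hA : IsCompact A)
    (hne : A.Nonempty) {r : ℝ} (hr : 0 < r) {N : ℕ} (hN : coveringCount A r ≤ N) :
    ∃ x : Fin N → A, ∀ y ∈ A, ∃ j, dist y (x j : E) < r := by
  obtain ⟨x, hxA, hx⟩ := exists_cover hA hr
  obtain ⟨a, ha⟩ := hne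
  refine ⟨fun j => if h : (j : ℕ) < coveringCount A r then ⟨x ⟨j, h⟩, hxA _⟩ else ⟨a, ha⟩,
    fun y hy => ?_⟩
  obtain ⟨j, hj⟩ := Set.mem_iUnion.1 (hx hy)
  exact ⟨⟨j, j.2.trans_le hN⟩, by simpa using hj⟩

lemma coveringCount_pos {E : Type*} [MetricSpace E] {A : Set E} (hA : IsCompact A)
    (hne : A.Nonempty) {r : ℝ} (hr : 0 < r) : 0 < coveringCount A r := by
  obtain ⟨x, hx⟩ := exists_config hA hne hr le_rfl
  obtain ⟨y, hy⟩ := hne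
  obtain ⟨j, -⟩ := hx y hy
  exact j.pos

lemma exists_finset_cover {a b r : ℝ} (hr : 0 < r) :
    ∃ S : Finset (EuclideanSpace ℝ (Fin d)), S.card ≤ coveringCount (cube d a b) r ∧
      ∀ y ∈ cube d a b, ∃ x ∈ S, dist y x < r := by
  classical
  obtain ⟨x, -, hx⟩ := exists_cover (isCompact_cube (d := d) a b) hr
  refine ⟨Finset.univ.image x, Finset.card_image_le.trans (by simp), fun y hy => ?_⟩
  obtain ⟨j, hj⟩ := Set.mem_iUnion.1 (hx hy)
  exact ⟨x j, by simp, by simpa using hj⟩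

lemma coveringCount_antitone {a b r r' : ℝ} (h : a ≤ b) (hr : 0 < r) (hrr : r ≤ r') :
    coveringCount (cube d a b) r' ≤ coveringCount (cube d a b) r := by
  obtain ⟨S, hS, hc⟩ := exists_finset_cover (d := d) (a := a) (b := b) hr
  refine (coveringCount_le_card h S fun y hy => ?_).trans hS
  obtain ⟨x, hx, hxy⟩ := hc y hy
  exact ⟨x, hx, hxy.trans_le hrr⟩

/-! ### Scaling and tiling -/

/-- The point of `ℝ^d` obtained from `x` by an homothety of ratio `c` and a translation by `v`. -/
noncomputable def homothety (c : ℝ) (v : Fin d → ℝ) (x : EuclideanSpace ℝ (Fin d)) :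
    EuclideanSpace ℝ (Fin d) := c • x + WithLp.toLp 2 v

@[simp] lemma homothety_apply (c : ℝ) (v : Fin d → ℝ) (x : EuclideanSpace ℝ (Fin d)) (i : Fin d) :
    homothety c v x i = c * x i + v i := by
  simp [homothety]

lemma dist_homothety {c : ℝ} (hc : 0 ≤ c) (v : Fin d → ℝ) (x y : EuclideanSpace ℝ (Fin d)) :
    dist (homothety c v x) (homothety c v y) = c * dist x y := by
  rw [homothety, homothety, dist_add_right, dist_smul₀, Real.norm_of_nonneg hc]

lemma exists_homothety_eq {c : ℝ} (hc : c ≠ 0) (v : Fin d → ℝ) (y : EuclideanSpace ℝ (Fin d)) :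
    ∃ x, homothety c v x = y ∧ ∀ i, x i = (y i - v i) / c := by
  refine ⟨WithLp.toLp 2 fun i => (y i - v i) / c, ?_, fun i => rfl⟩
  ext i
  simp [mul_div_cancel₀ _ hc]

lemma coveringCount_homothety_le {a b r c v : ℝ} (h : a ≤ b) (hr : 0 < r) (hc : 0 < c) :
    coveringCount (cube d (c * a + v) (c * b + v)) (c * r) ≤ coveringCount (cube d a b) r := by
  classical
  obtain ⟨S, hS, hcov⟩ := exists_finset_cover (d := d) (a := a) (b := b) hr
  refine (coveringCount_le_card (by gcongr) (S.image (homothety c fun _ => v)) fun y hy => ?_).trans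
    (Finset.card_image_le.trans hS)
  obtain ⟨x, rfl, hx⟩ := exists_homothety_eq hc.ne' (fun _ => v) y
  obtain ⟨z, hz, hzx⟩ := hcov x fun i => by
    have := hy i
    simp only [homothety_apply, Set.mem_Icc, add_le_add_iff_right, mul_le_mul_iff_right₀ hc] at this
    exact this
  refine ⟨_, Finset.mem_image_of_mem _ hz, ?_⟩
  rw [dist_homothety hc.le]
  gcongr

lemma coveringCount_homothety {a b r c v : ℝ} (h : a ≤ b) (hr : 0 < r) (hc : 0 < c) :
    coveringCount (cube d (c * a + v) (c * b + v)) (c * r) = coveringCount (cube d a b) r := by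
  refine le_antisymm (coveringCount_homothety_le h hr hc) ?_
  have := coveringCount_homothety_le (d := d) (a := c * a + v) (b := c * b + v) (r := c * r)
    (c := c⁻¹) (v := -(c⁻¹ * v)) (by gcongr) (by positivity) (by positivity)
  have e : ∀ t, c⁻¹ * (c * t + v) + -(c⁻¹ * v) = t := fun t => by field_simp; ring
  rwa [e, e, inv_mul_cancel_left₀ hc.ne'] at this

lemma coveringCount_cube_one {R : ℝ} (hR : 0 < R) :
    coveringCount (cube d (-R) R) 1 = coveringCount (cube d 0 1) (2 * R)⁻¹ := by
  rw [← coveringCount_homothety (d := d) (a := 0) (b := 1) (r := (2 * R)⁻¹) (c := 2 * R) (v := -R)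
    zero_le_one (by positivity) (by positivity)]
  congr 1
  · congr 1 <;> ring
  · field_simp

/-- The unit cube is the union of `k^d` cubes of side `1 / k`. -/
lemma exists_subcube {k : ℕ} (hk : 0 < k) {y : EuclideanSpace ℝ (Fin d)} (hy : y ∈ cube d 0 1) :
    ∃ z : Fin d → Fin k, ∃ x ∈ cube d 0 1, homothety (k : ℝ)⁻¹ (fun i => (k : ℝ)⁻¹ * z i) x = y := by
  have hk' : (0 : ℝ) < k := by exact_mod_cast hk
  have key : ∀ i, ∃ z : Fin k, (z : ℝ) ≤ k * y i ∧ k * y i ≤ z + 1 := fun i => by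
    obtain ⟨h0, h1⟩ := hy i
    rcases h1.eq_or_lt with h1 | h1
    · refine ⟨⟨k - 1, by omega⟩, ?_⟩
      simp [h1, Nat.cast_sub (Nat.one_le_of_lt hk)]
    · have h2 : 0 ≤ k * y i := by positivity
      refine ⟨⟨⌊k * y i⌋₊, (Nat.floor_lt h2).2 ?_⟩, Nat.floor_le h2, (Nat.lt_floor_add_one _).le⟩
      nlinarith
  choose z hz using key
  obtain ⟨x, hx, hx'⟩ := exists_homothety_eq (inv_ne_zero hk'.ne') (fun i => (k : ℝ)⁻¹ * z i) y
  refine ⟨z, x, fun i => ?_, hx⟩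
  have : x i = k * y i - z i := by rw [hx' i]; field_simp
  rw [this]
  exact ⟨by linarith [(hz i).1], by linarith [(hz i).2]⟩

/-- Each of the k^d subcubes receives a shrunken copy of one cover of the whole cube. -/
lemma coveringCount_div_le {r : ℝ} (hr : 0 < r) {k : ℕ} (hk : 0 < k) :
    coveringCount (cube d 0 1) (r / k) ≤ k ^ d * coveringCount (cube d 0 1) r := by
  classical
  have hk' : (0 : ℝ) < k := by exact_mod_cast hk
  obtain ⟨S, hS, hcov⟩ := exists_finset_cover (d := d) (a := 0) (b := 1) hr
  let T : Finset (EuclideanSpace ℝ (Fin d)) := (Finset.univ ×ˢ S).image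
    fun p : (Fin d → Fin k) × EuclideanSpace ℝ (Fin d) =>
      homothety (k : ℝ)⁻¹ (fun i => (k : ℝ)⁻¹ * p.1 i) p.2
  have hT : T.card ≤ k ^ d * coveringCount (cube d 0 1) r :=
    Finset.card_image_le.trans (by simpa using Nat.mul_le_mul_left _ hS)
  refine (coveringCount_le_card zero_le_one T fun y hy => ?_).trans hT
  obtain ⟨z, x, hx, rfl⟩ := exists_subcube hk hy
  obtain ⟨w, hw, hxw⟩ := hcov x hx
  refine ⟨_, Finset.mem_image.2 ⟨(z, w), by simpa using hw, rfl⟩, ?_⟩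
  rw [dist_homothety (by positivity), div_eq_inv_mul]
  gcongr

/-! ### The limit of r^d N(r) -/

variable (d) in
/-- The limit of `r^d N_{[0,1]^d}(r)` as `r → 0`. -/
noncomputable def coveringConstant : ℝ :=
  sInf ((fun r : ℝ => r ^ d * (coveringCount (cube d 0 1) r : ℝ)) '' Set.Ioi 0)

lemma coveringConstant_le {r : ℝ} (hr : 0 < r) :
    coveringConstant d ≤ r ^ d * (coveringCount (cube d 0 1) r : ℝ) := by
  refine csInf_le ⟨0, ?_⟩ ⟨r, hr, rfl⟩
  rintro _ ⟨t, ht, rfl⟩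
  have : (0 : ℝ) < t := ht
  positivity

/-- Tile with k = ⌈r'/r⌉: then r'/k ≤ r, and rounding costs only rk ≤ r' + r. For fixed r' the loss
vanishes as r → 0, so the infimum is a limit. -/
lemma le_mul_coveringCount {r r' : ℝ} (hr : 0 < r) (hr' : 0 < r') :
    r ^ d * (coveringCount (cube d 0 1) r : ℝ) ≤
      (r' + r) ^ d * (coveringCount (cube d 0 1) r' : ℝ) := by
  have hk : 0 < ⌈r' / r⌉₊ := Nat.ceil_pos.2 (by positivity)
  have hk' : (0 : ℝ) < ⌈r' / r⌉₊ := by exact_mod_cast hk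
  have h1 : coveringCount (cube d 0 1) r ≤ ⌈r' / r⌉₊ ^ d * coveringCount (cube d 0 1) r' :=
    (coveringCount_antitone zero_le_one (by positivity)
      ((div_le_comm₀ hr hk').1 (Nat.le_ceil _))).trans (coveringCount_div_le hr' hk)
  have h2 : r * ⌈r' / r⌉₊ ≤ r' + r := by
    have := (Nat.ceil_lt_add_one (a := r' / r) (by positivity)).le
    calc r * ⌈r' / r⌉₊ ≤ r * (r' / r + 1) := by gcongr
      _ = r' + r := by field_simp
  calc r ^ d * (coveringCount (cube d 0 1) r : ℝ)
      ≤ r ^ d * (⌈r' / r⌉₊ ^ d * coveringCount (cube d 0 1) r' : ℕ) := by gcongr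
    _ = (r * ⌈r' / r⌉₊) ^ d * coveringCount (cube d 0 1) r' := by push_cast; ring
    _ ≤ _ := by gcongr

lemma tendsto_coveringCount :
    Tendsto (fun r : ℝ => r ^ d * (coveringCount (cube d 0 1) r : ℝ)) (𝓝[>] 0)
      (𝓝 (coveringConstant d)) := by
  refine tendsto_order.2 ⟨fun c hc => ?_, fun c hc => ?_⟩
  · filter_upwards [self_mem_nhdsWithin] with r hr
    exact hc.trans_le (coveringConstant_le hr)
  · obtain ⟨_, ⟨r', hr', rfl⟩, hlt⟩ := exists_lt_of_csInf_lt (Set.nonempty_Ioi.image _) hc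
    have h1 : Tendsto (fun r : ℝ => (r' + r) ^ d * (coveringCount (cube d 0 1) r' : ℝ)) (𝓝[>] 0)
        (𝓝 ((r' + 0) ^ d * (coveringCount (cube d 0 1) r' : ℝ))) :=
      (Continuous.tendsto (by fun_prop) 0).mono_left nhdsWithin_le_nhds
    rw [add_zero] at h1
    filter_upwards [self_mem_nhdsWithin, h1.eventually_lt_const hlt] with r hr hr2
    exact (le_mul_coveringCount hr hr').trans_lt hr2

lemma tendsto_coveringCount_cube :
    Tendsto (fun R : ℝ => (coveringCount (cube d (-R) R) 1 : ℝ) / (2 * R) ^ d) atTop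
      (𝓝 (coveringConstant d)) := by
  have h : Tendsto (fun R : ℝ => (2 * R)⁻¹) atTop (𝓝[>] 0) :=
    tendsto_inv_atTop_nhdsGT_zero.comp (tendsto_id.const_mul_atTop two_pos)
  refine (tendsto_coveringCount.comp h).congr' ?_
  filter_upwards [eventually_gt_atTop 0] with R hR
  simp only [Function.comp]
  rw [coveringCount_cube_one hR, inv_pow, div_eq_inv_mul]

/-- Comparing volumes, N(r) balls of volume r^d V must fill volume 1, so 1/V is a lower bound. -/
lemma coveringConstant_pos : 0 < coveringConstant d := by
  set V := volume (Metric.ball (0 : EuclideanSpace ℝ (Fin d)) 1) with hV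
  have hV0 : 0 < V := Metric.measure_ball_pos _ _ one_pos
  have hVt : V ≠ ⊤ := measure_ball_lt_top.ne
  have hVr : 0 < V.toReal := ENNReal.toReal_pos hV0.ne' hVt
  refine lt_of_lt_of_le (inv_pos.2 hVr) (le_csInf (Set.nonempty_Ioi.image _) ?_)
  rintro _ ⟨r, hr, rfl⟩
  have hr : 0 < r := hr
  obtain ⟨S, hS, hc⟩ := exists_finset_cover (d := d) (a := 0) (b := 1) hr
  have h1 : volume (cube d 0 1) ≤ S.card * (ENNReal.ofReal (r ^ d) * V) := by
    refine (measure_mono (t := ⋃ x ∈ S, Metric.ball x r) fun y hy => ?_).trans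
      ((measure_biUnion_finset_le _ _).trans_eq ?_)
    · obtain ⟨x, hx, h⟩ := hc y hy
      exact Set.mem_iUnion₂.2 ⟨x, hx, h⟩
    · simp only [Measure.addHaar_ball_of_pos volume _ hr]
      simp [V]
  rw [volume_cube] at h1
  have h2 := ENNReal.toReal_mono (by finiteness) h1
  simp only [sub_zero, ENNReal.ofReal_one, one_pow, ENNReal.toReal_one, ENNReal.toReal_mul,
    ENNReal.toReal_natCast, ENNReal.toReal_ofReal (pow_nonneg hr.le d)] at h2
  rw [inv_le_iff_one_le_mul₀ hVr]
  refine h2.trans ?_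
  have : (S.card : ℝ) ≤ coveringCount (cube d 0 1) r := by exact_mod_cast hS
  calc (S.card : ℝ) * (r ^ d * V.toReal) ≤ coveringCount (cube d 0 1) r * (r ^ d * V.toReal) := by
        gcongr
    _ = _ := by ring

/-! ### Covering radius as the inverse of the covering number -/

section CoveringRadius

variable {E : Type*} [MetricSpace E] {A : Set E}

lemma configCoveringRadius_nonneg {N : ℕ} (x : Fin N → A) : 0 ≤ configCoveringRadius A x :=
  Real.iSup_nonneg fun _ => Real.iInf_nonneg fun _ => dist_nonneg

lemma coveringRadius_nonneg {N : ℕ} : 0 ≤ coveringRadius A N :=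
  Real.iInf_nonneg configCoveringRadius_nonneg

lemma bddBelow_range_dist {N : ℕ} (x : Fin N → A) (y : A) :
    BddBelow (Set.range fun j => dist (y : E) (x j : E)) :=
  ⟨0, by rintro _ ⟨j, rfl⟩; exact dist_nonneg⟩

lemma coveringRadius_le (hA : IsCompact A) (hne : A.Nonempty) {r : ℝ} (hr : 0 < r) {N : ℕ}
    (hN : coveringCount A r ≤ N) : coveringRadius A N ≤ r := by
  obtain ⟨x, hx⟩ := exists_config hA hne hr hN
  refine (ciInf_le ⟨0, ?_⟩ x).trans ?_
  · rintro _ ⟨x, rfl⟩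
    exact configCoveringRadius_nonneg x
  · refine Real.iSup_le (fun y => ?_) hr.le
    obtain ⟨j, hj⟩ := hx y y.2
    exact (ciInf_le (bddBelow_range_dist x y) j).trans hj.le

lemma coveringCount_le (hA : IsCompact A) (hne : A.Nonempty) {r : ℝ} {N : ℕ}
    (hN : 0 < N) (h : coveringRadius A N < r) : coveringCount A r ≤ N := by
  have : Nonempty A := hne.to_subtype
  -- For N = 0 the real infimum over an empty type is 0, so the claim would fail.
  have : Nonempty (Fin N) := ⟨⟨0, hN⟩⟩
  obtain ⟨x, hx⟩ := exists_lt_of_ciInf_lt h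
  refine Nat.sInf_le ⟨fun j => x j, fun j => (x j).2, fun y hy => ?_⟩
  have hb : BddAbove (Set.range fun y : A => ⨅ j, dist (y : E) (x j : E)) := by
    obtain ⟨C, hC⟩ := (Metric.isBounded_iff.1 hA.isBounded)
    refine ⟨C, ?_⟩
    rintro _ ⟨y, rfl⟩
    exact (ciInf_le (bddBelow_range_dist x y) ⟨0, hN⟩).trans (hC y.2 (x _).2)
  obtain ⟨j, hj⟩ := exists_lt_of_ciInf_lt ((le_ciSup hb ⟨y, hy⟩).trans_lt hx)
  exact Set.mem_iUnion.2 ⟨j, hj⟩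

end CoveringRadius

lemma tendsto_root {d : ℕ} (hd : d ≠ 0) {c : ℝ} (hc : 0 < c) :
    Tendsto (fun N : ℕ => (c / N) ^ (d : ℝ)⁻¹) atTop (𝓝[>] 0) := by
  refine tendsto_nhdsWithin_iff.2 ⟨?_, ?_⟩
  · have h1 : Tendsto (fun N : ℕ => c / (N : ℝ)) atTop (𝓝 0) :=
      tendsto_const_div_atTop_nhds_zero_nat c
    have h2 := h1.rpow_const (p := (d : ℝ)⁻¹) (Or.inr (by positivity))
    rwa [Real.zero_rpow (by positivity)] at h2
  · filter_upwards [eventually_gt_atTop 0] with N hN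
    have : (0 : ℝ) < N := by exact_mod_cast hN
    exact Real.rpow_pos_of_pos (by positivity) _

/-- With r = (c'/N)^(1/d), comparing r^d N(r) with c' = r^d N is comparing N(r) with N, hence the
covering radius with r. -/
lemma tendsto_coveringRadius (hd : d ≠ 0) :
    Tendsto (fun N : ℕ => (N : ℝ) * coveringRadius (cube d 0 1) N ^ d) atTop
      (𝓝 (coveringConstant d)) := by
  have hA := isCompact_cube (d := d) 0 1
  have hne := cube_nonempty (d := d) zero_le_one
  have hroot : ∀ {c : ℝ}, 0 < c → ∀ {N : ℕ}, 0 < N →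
      ((c / N) ^ (d : ℝ)⁻¹) ^ d = c / N := fun hc N hN =>
    Real.rpow_inv_natCast_pow (by positivity) hd
  refine tendsto_order.2 ⟨fun c hc => ?_, fun c hc => ?_⟩
  · obtain ⟨c', hc', hc2⟩ := exists_between (max_lt hc coveringConstant_pos)
    obtain ⟨hcc, h0⟩ := max_lt_iff.1 hc'
    filter_upwards [eventually_gt_atTop 0,
      (tendsto_root hd h0).eventually (tendsto_coveringCount.eventually_const_lt hc2),
      (tendsto_root hd h0).eventually self_mem_nhdsWithin] with N hN h1 hr
    have hN' : (0 : ℝ) < N := by exact_mod_cast hN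
    rw [hroot h0 hN] at h1
    refine hcc.trans_le ?_
    by_contra! h2
    have h3 : coveringRadius (cube d 0 1) N < (c' / N) ^ (d : ℝ)⁻¹ := by
      refine lt_of_pow_lt_pow_left₀ d (le_of_lt hr) ?_
      rw [hroot h0 hN, lt_div_iff₀ hN']
      linarith
    have h4 : (coveringCount (cube d 0 1) ((c' / N) ^ (d : ℝ)⁻¹) : ℝ) ≤ N := by
      exact_mod_cast coveringCount_le hA hne hN h3
    have : c' / N * (coveringCount (cube d 0 1) ((c' / N) ^ (d : ℝ)⁻¹) : ℝ) ≤ c' / N * N := by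
      gcongr
    rw [div_mul_cancel₀ _ hN'.ne'] at this
    linarith
  · obtain ⟨c', hc', hc2⟩ := exists_between hc
    have h0 := coveringConstant_pos.trans hc'
    filter_upwards [eventually_gt_atTop 0,
      (tendsto_root hd h0).eventually (tendsto_coveringCount.eventually_lt_const hc'),
      (tendsto_root hd h0).eventually self_mem_nhdsWithin] with N hN h1 hr
    have hN' : (0 : ℝ) < N := by exact_mod_cast hN
    rw [hroot h0 hN] at h1
    refine lt_of_le_of_lt ?_ hc2
    have h4 : (coveringCount (cube d 0 1) ((c' / N) ^ (d : ℝ)⁻¹) : ℝ) ≤ N := by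
      by_contra! h
      have : c' / N * N < c' / N * (coveringCount (cube d 0 1) ((c' / N) ^ (d : ℝ)⁻¹) : ℝ) := by
        gcongr
      rw [div_mul_cancel₀ _ hN'.ne'] at this
      linarith
    have h5 := pow_le_pow_left₀ coveringRadius_nonneg
      (coveringRadius_le hA hne hr (by exact_mod_cast h4)) d
    rw [hroot h0 hN, le_div_iff₀ hN'] at h5
    linarith

/-! ### Lower bound for covering densities -/

lemma unitBallVolume_eq :
    unitBallVolume d = volume (Metric.ball (0 : EuclideanSpace ℝ (Fin d)) 1) :=
  Measure.addHaar_unitClosedBall_eq_addHaar_unitBall volume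

lemma volume_ball_one (x : EuclideanSpace ℝ (Fin d)) :
    volume (Metric.ball x 1) = unitBallVolume d := by
  rw [unitBallVolume_eq, Measure.addHaar_ball_center]

lemma unitBallVolume_ne_zero : unitBallVolume d ≠ 0 := by
  rw [unitBallVolume_eq]
  exact (Metric.measure_ball_pos _ _ one_pos).ne'

lemma unitBallVolume_ne_top : unitBallVolume d ≠ ⊤ := by
  rw [unitBallVolume_eq]
  exact measure_ball_lt_top.ne

lemma abs_sub_apply_le_dist (x y : EuclideanSpace ℝ (Fin d)) (i : Fin d) :
    |x i - y i| ≤ dist x y := by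
  rw [dist_eq_norm]
  exact PiLp.norm_apply_le (x - y) i

lemma ball_subset_cube {R : ℝ} {c : EuclideanSpace ℝ (Fin d)}
    (h : ∃ y ∈ cube d (-(R - 2)) (R - 2), dist y c < 1) : Metric.ball c 1 ⊆ cube d (-R) R := by
  obtain ⟨y, hy, hyc⟩ := h
  intro w hw i
  have h1 := abs_le.1 ((abs_sub_apply_le_dist y c i).trans hyc.le)
  have h2 := abs_le.1 ((abs_sub_apply_le_dist w c i).trans (Metric.mem_ball.1 hw).le)
  have h3 := hy i
  exact ⟨by linarith [h3.1], by linarith [h3.2]⟩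

lemma coveringCount_mul_le_tsum {C : Set (EuclideanSpace ℝ (Fin d))}
    (hC : (⋃ c ∈ C, Metric.ball c 1) = Set.univ) {R : ℝ} (hR : 2 ≤ R) :
    (coveringCount (cube d (-(R - 2)) (R - 2)) 1 : ℝ≥0∞) * unitBallVolume d ≤
      ∑' c : C, volume (Metric.ball (c : EuclideanSpace ℝ (Fin d)) 1 ∩ cube d (-R) R) := by
  set S := {c ∈ C | ∃ y ∈ cube d (-(R - 2)) (R - 2), dist y c < 1} with hS
  obtain ⟨T, hTS, hT⟩ : ∃ T : Finset (EuclideanSpace ℝ (Fin d)), (T : Set _) ⊆ S ∧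
      coveringCount (cube d (-(R - 2)) (R - 2)) 1 ≤ T.card := by
    -- The family need not be locally finite; if infinitely many balls meet the inner cube, any
    -- finite subfamily of the required size suffices.
    by_cases hfin : S.Finite
    · refine ⟨hfin.toFinset, by simp, coveringCount_le_card (by linarith) _ fun y hy => ?_⟩
      obtain ⟨c, hc, hyc⟩ := Set.mem_iUnion₂.1 (hC.symm ▸ Set.mem_univ y)
      exact ⟨c, hfin.mem_toFinset.2 ⟨hc, y, hy, hyc⟩, hyc⟩
    · obtain ⟨T, hT, hcard⟩ := Set.Infinite.exists_subset_card_eq hfin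
        (coveringCount (cube d (-(R - 2)) (R - 2)) 1)
      exact ⟨T, hT, hcard.ge⟩
  calc (coveringCount (cube d (-(R - 2)) (R - 2)) 1 : ℝ≥0∞) * unitBallVolume d
      ≤ T.card * unitBallVolume d := by gcongr
    _ = ∑ c ∈ T, C.indicator (fun c => volume (Metric.ball c 1 ∩ cube d (-R) R)) c := by
        rw [Finset.sum_congr rfl (g := fun _ => unitBallVolume d), Finset.sum_const, nsmul_eq_mul]
        intro c hc
        have := hTS hc
        rw [Set.indicator_of_mem this.1, Set.inter_eq_left.2 (ball_subset_cube this.2),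
          volume_ball_one]
    _ ≤ _ := by
        rw [tsum_subtype C fun c => volume (Metric.ball c 1 ∩ cube d (-R) R)]
        exact ENNReal.sum_le_tsum T

lemma le_of_hasDensity {C : Set (EuclideanSpace ℝ (Fin d))} {D : ℝ≥0∞}
    (hC : (⋃ c ∈ C, Metric.ball c 1) = Set.univ) (hD : HasDensity C D) :
    ENNReal.ofReal (coveringConstant d) * unitBallVolume d ≤ D := by
  have h1 : Tendsto (fun R : ℝ => coveringConstant d * (1 - 2 * R⁻¹) ^ d) atTop
      (𝓝 (coveringConstant d * (1 - 2 * 0) ^ d)) :=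
    ((tendsto_inv_atTop_zero.const_mul 2).const_sub 1).pow d |>.const_mul _
  have h2 := ENNReal.Tendsto.mul_const (b := unitBallVolume d) (ENNReal.tendsto_ofReal h1)
    (Or.inr unitBallVolume_ne_top)
  simp only [mul_zero, sub_zero, one_pow, mul_one] at h2
  refine le_of_tendsto_of_tendsto h2 hD ?_
  filter_upwards [eventually_gt_atTop 2] with R hR
  have hR0 : 0 < R := by linarith
  rw [ENNReal.le_div_iff_mul_le (Or.inl (by simp; positivity)) (Or.inl (by finiteness))]
  refine le_trans ?_ (coveringCount_mul_le_tsum hC hR.le)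
  rw [mul_right_comm, ← ENNReal.ofReal_mul (mul_nonneg coveringConstant_pos.le
    (pow_nonneg (by rw [sub_nonneg, ← div_eq_mul_inv, div_le_one hR0]; exact hR.le) d)),
    ← ENNReal.ofReal_natCast]
  refine mul_le_mul_left (ENNReal.ofReal_le_ofReal ?_) _
  -- At this radius the infimum bound reads θ (2(R-2))^d ≤ N; the ratio to (2R)^d is (1 - 2/R)^d.
  have h3 := coveringConstant_le (d := d) (r := (2 * (R - 2))⁻¹) (inv_pos.2 (by linarith))
  rw [← coveringCount_cube_one (by linarith), inv_pow,
    inv_mul_eq_div, le_div_iff₀ (by have : 0 < R - 2 := by linarith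
                                    positivity)] at h3
  refine le_of_eq_of_le ?_ h3
  rw [mul_assoc, ← mul_pow]
  congr 2
  field_simp

/-! ### Periodic coverings -/

/-- Translation by the vector `L z` of the lattice `L ℤ^d`. -/
noncomputable def latticeVector (L : ℝ) (z : Fin d → ℤ) : EuclideanSpace ℝ (Fin d) :=
  WithLp.toLp 2 fun i => L * z i

@[simp] lemma latticeVector_apply (L : ℝ) (z : Fin d → ℤ) (i : Fin d) :
    latticeVector L z i = L * z i := rfl

lemma toNat_card_bounds {a b : ℝ} (h : a ≤ b) :
    b - a - 1 ≤ ((⌊b⌋ + 1 - ⌈a⌉).toNat : ℝ) ∧ ((⌊b⌋ + 1 - ⌈a⌉).toNat : ℝ) ≤ b - a + 1 := by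
  have h1 := Int.lt_floor_add_one b
  have h2 := Int.floor_le b
  have h3 := Int.ceil_lt_add_one a
  have h4 := Int.le_ceil a
  have e : ((⌊b⌋ + 1 - ⌈a⌉).toNat : ℝ) = max ((⌊b⌋ : ℝ) + 1 - ⌈a⌉) 0 := by
    rw [← Int.cast_natCast, Int.toNat_eq_max]
    push_cast
    rfl
  rw [e]
  exact ⟨le_max_of_le_left (by linarith), max_le (by linarith) (by linarith)⟩

lemma tsum_indicator_cube_bounds {L R : ℝ} (hL : 0 < L) (hR : L ≤ R)
    (y : EuclideanSpace ℝ (Fin d)) :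
    ENNReal.ofReal ((2 * R / L - 1) ^ d) ≤
        ∑' z : Fin d → ℤ, (cube d (-R) R).indicator (1 : EuclideanSpace ℝ (Fin d) → ℝ≥0∞) (y + latticeVector L z) ∧
      ∑' z : Fin d → ℤ, (cube d (-R) R).indicator (1 : EuclideanSpace ℝ (Fin d) → ℝ≥0∞) (y + latticeVector L z) ≤
        ENNReal.ofReal ((2 * R / L + 1) ^ d) := by
  have hR0 : 0 < R := hL.trans_le hR
  set Z : Finset (Fin d → ℤ) :=
    Fintype.piFinset fun i => Finset.Icc ⌈(-R - y i) / L⌉ ⌊(R - y i) / L⌋ with hZ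
  have hmem : ∀ z, z ∈ Z ↔ y + latticeVector L z ∈ cube d (-R) R := fun z => by
    simp only [hZ, Fintype.mem_piFinset, Finset.mem_Icc, Int.ceil_le, Int.le_floor, cube,
      Set.mem_ofPred_eq, Set.mem_Icc, PiLp.add_apply, latticeVector_apply]
    refine forall_congr' fun i => ?_
    rw [div_le_iff₀ hL, le_div_iff₀ hL]
    constructor <;> rintro ⟨h1, h2⟩ <;> constructor <;> linarith
  have hsum : ∑' z : Fin d → ℤ, (cube d (-R) R).indicator (1 : EuclideanSpace ℝ (Fin d) → ℝ≥0∞)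
      (y + latticeVector L z) = ENNReal.ofReal (Z.card : ℝ) := by
    rw [tsum_eq_sum (s := Z) fun z hz => Set.indicator_of_notMem (fun h => hz ((hmem z).2 h)) _,
      Finset.sum_congr rfl fun z hz => Set.indicator_of_mem ((hmem z).1 hz) _]
    simp
  have hb : ∀ i, 2 * R / L - 1 ≤ ((⌊(R - y i) / L⌋ + 1 - ⌈(-R - y i) / L⌉).toNat : ℝ) ∧
      ((⌊(R - y i) / L⌋ + 1 - ⌈(-R - y i) / L⌉).toNat : ℝ) ≤ 2 * R / L + 1 := fun i => by
    have h := toNat_card_bounds (a := (-R - y i) / L) (b := (R - y i) / L) (by gcongr; linarith)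
    rwa [show (R - y i) / L - (-R - y i) / L = 2 * R / L by ring] at h
  have hcard : (Z.card : ℝ) = ∏ i, ((⌊(R - y i) / L⌋ + 1 - ⌈(-R - y i) / L⌉).toNat : ℝ) := by
    simp [hZ, Fintype.card_piFinset]
  -- This is where L ≤ R enters: the lower factors must be nonnegative to be multiplied over
  -- coordinates.
  have h1 : 0 ≤ 2 * R / L - 1 := by
    rw [sub_nonneg, one_le_div hL]
    linarith
  rw [hsum, hcard]
  constructor
  · refine ENNReal.ofReal_le_ofReal ?_
    have := Finset.prod_le_prod (s := Finset.univ) (fun i _ => h1) fun i _ => (hb i).1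
    simpa using this
  · refine ENNReal.ofReal_le_ofReal ?_
    have := Finset.prod_le_prod (s := Finset.univ) (fun i _ => Nat.cast_nonneg _) fun i _ =>
      (hb i).2
    simpa using this

lemma measurableSet_cube (a b : ℝ) : MeasurableSet (cube d a b) :=
  (isCompact_cube a b).isClosed.measurableSet

lemma volume_ball_add_inter (x v : EuclideanSpace ℝ (Fin d)) {A : Set (EuclideanSpace ℝ (Fin d))}
    (hA : MeasurableSet A) :
    volume (Metric.ball (x + v) 1 ∩ A) =
      ∫⁻ y in Metric.ball x 1, A.indicator (1 : EuclideanSpace ℝ (Fin d) → ℝ≥0∞) (y + v) := by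
  have h1 : (fun y => A.indicator (1 : EuclideanSpace ℝ (Fin d) → ℝ≥0∞) (y + v)) =
      ((fun y => y + v) ⁻¹' A).indicator 1 := rfl
  rw [h1, lintegral_indicator_one (measurable_add_const v hA),
    Measure.restrict_apply (measurable_add_const v hA),
    ← measure_preimage_add_right volume v (Metric.ball (x + v) 1 ∩ A)]
  congr 1
  ext y
  simp [and_comm]

/-- Exchanging sum and integral reduces the volume of a lattice orbit of balls to counting lattice
points, with bounds uniform in y. -/
lemma tsum_volume_eq (x : EuclideanSpace ℝ (Fin d)) (L R : ℝ) :
    ∑' z : Fin d → ℤ, volume (Metric.ball (x + latticeVector L z) 1 ∩ cube d (-R) R) =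
      ∫⁻ y in Metric.ball x 1,
        ∑' z : Fin d → ℤ, (cube d (-R) R).indicator (1 : EuclideanSpace ℝ (Fin d) → ℝ≥0∞) (y + latticeVector L z) := by
  refine Eq.trans (tsum_congr fun z => volume_ball_add_inter _ _ (measurableSet_cube _ _))
    (lintegral_tsum fun z => Measurable.aemeasurable ?_).symm
  exact (measurable_one.indicator (measurableSet_cube _ _)).comp (measurable_add_const _)

lemma tendsto_tsum_volume (x : EuclideanSpace ℝ (Fin d)) {L : ℝ} (hL : 0 < L) :
    Tendsto (fun R : ℝ => (∑' z : Fin d → ℤ,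
      volume (Metric.ball (x + latticeVector L z) 1 ∩ cube d (-R) R)) /
        ENNReal.ofReal ((2 * R) ^ d)) atTop
      (𝓝 (ENNReal.ofReal (L⁻¹ ^ d) * unitBallVolume d)) := by
  have key : ∀ e : ℝ, Tendsto (fun R : ℝ => ENNReal.ofReal ((2 * R / L + e) ^ d) *
      unitBallVolume d / ENNReal.ofReal ((2 * R) ^ d)) atTop
      (𝓝 (ENNReal.ofReal (L⁻¹ ^ d) * unitBallVolume d)) := fun e => by
    have h1 : Tendsto (fun R : ℝ => (L⁻¹ + e / 2 * R⁻¹) ^ d) atTop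
        (𝓝 ((L⁻¹ + e / 2 * 0) ^ d)) :=
      ((tendsto_inv_atTop_zero.const_mul (e / 2)).const_add L⁻¹).pow d
    rw [mul_zero, add_zero] at h1
    refine (ENNReal.Tendsto.mul_const (ENNReal.tendsto_ofReal h1)
      (Or.inr unitBallVolume_ne_top)).congr' ?_
    filter_upwards [eventually_gt_atTop 0] with R hR
    rw [ENNReal.mul_div_right_comm, ← ENNReal.ofReal_div_of_pos (by positivity), ← div_pow]
    congr 3
    field_simp
  refine tendsto_of_tendsto_of_tendsto_of_le_of_le' (key (-1)) (key 1) ?_ ?_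
  · filter_upwards [eventually_ge_atTop L] with R hR
    gcongr
    rw [tsum_volume_eq, ← volume_ball_one x, ← setLIntegral_const]
    exact lintegral_mono fun y => (tsum_indicator_cube_bounds hL hR y).1
  · filter_upwards [eventually_ge_atTop L] with R hR
    gcongr
    rw [tsum_volume_eq, ← volume_ball_one x, ← setLIntegral_const]
    exact lintegral_mono fun y => (tsum_indicator_cube_bounds hL hR y).2

lemma exists_lattice_reduction {L : ℝ} (hL : 0 < L) (x : EuclideanSpace ℝ (Fin d)) :
    ∃ z : Fin d → ℤ, ∀ i, (x + latticeVector L z) i ∈ Set.Ico 0 L := by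
  refine ⟨fun i => -⌊x i / L⌋, fun i => ?_⟩
  simp only [PiLp.add_apply, latticeVector_apply, Int.cast_neg, Set.mem_Ico]
  have h1 := (le_div_iff₀ hL).1 (Int.floor_le (x i / L))
  have h2 := (div_lt_iff₀ hL).1 (Int.lt_floor_add_one (x i / L))
  constructor <;> linarith

lemma lattice_injective {L : ℝ} (hL : 0 < L) {x y : EuclideanSpace ℝ (Fin d)}
    (hx : ∀ i, x i ∈ Set.Ico 0 L) (hy : ∀ i, y i ∈ Set.Ico 0 L) {z w : Fin d → ℤ}
    (h : x + latticeVector L z = y + latticeVector L w) : x = y ∧ z = w := by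
  have hzw : z = w := by
    funext i
    have hi : x i + L * z i = y i + L * w i := by simpa using congrArg (fun u => u i) h
    have h1 : L * ((z i : ℝ) - w i) < L * 1 := by linarith [(hx i).1, (hy i).2]
    have h2 : L * ((w i : ℝ) - z i) < L * 1 := by linarith [(hx i).2, (hy i).1]
    have h1 := lt_of_mul_lt_mul_left h1 hL.le
    have h2 := lt_of_mul_lt_mul_left h2 hL.le
    have h3 : z i - w i < 1 := by exact_mod_cast h1
    have h4 : w i - z i < 1 := by exact_mod_cast h2
    omega
  subst hzw
  exact ⟨add_right_cancel h, rfl⟩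

/-- Only an upper bound on D is claimed, because reducing centers modulo the lattice may merge some
of them. -/
lemma exists_periodic_cover {L : ℝ} (hL : 0 < L) :
    ∃ C : Set (EuclideanSpace ℝ (Fin d)), ∃ D : ℝ≥0∞, (⋃ c ∈ C, Metric.ball c 1) = Set.univ ∧
      HasDensity C D ∧ D ≤ (coveringCount (cube d 0 L) 1 : ℝ≥0∞) *
        (ENNReal.ofReal (L⁻¹ ^ d) * unitBallVolume d) := by
  classical
  choose p hp using exists_lattice_reduction (d := d) hL
  obtain ⟨S, hS, hcov⟩ := exists_finset_cover (d := d) (a := 0) (b := L) one_pos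
  -- Densities are summed over a set of centers, so the parametrization by pairs must be injective;
  -- representatives in [0,L)^d ensure this.
  set X := S.image fun x => x + latticeVector L (p x) with hX
  have hX01 : ∀ x ∈ X, ∀ i, x i ∈ Set.Ico 0 L := by
    intro x hx
    obtain ⟨w, -, rfl⟩ := Finset.mem_image.1 hx
    exact hp w
  set f : X × (Fin d → ℤ) → EuclideanSpace ℝ (Fin d) := fun q => q.1 + latticeVector L q.2 with hf
  have hinj : Function.Injective f := fun q q' h => by
    obtain ⟨h1, h2⟩ := lattice_injective hL (hX01 _ q.1.2) (hX01 _ q'.1.2) h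
    exact Prod.ext (Subtype.ext h1) h2
  refine ⟨Set.range f, X.card * (ENNReal.ofReal (L⁻¹ ^ d) * unitBallVolume d), ?_, ?_, ?_⟩
  · refine Set.eq_univ_of_forall fun y => ?_
    obtain ⟨x, hx, hyx⟩ := hcov (y + latticeVector L (p y)) fun i => Set.Ico_subset_Icc_self (hp y i)
    -- The index undoes both reductions: it turns x + Lp(x) into x - Lp(y), whose distance to y is
    -- that from x to y + Lp(y).
    refine Set.mem_iUnion₂.2 ⟨f (⟨_, Finset.mem_image_of_mem _ hx⟩, -p x - p y), ⟨_, rfl⟩, ?_⟩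
    rw [Metric.mem_ball]
    refine lt_of_eq_of_lt ?_ hyx
    rw [dist_eq_norm, dist_eq_norm]
    congr 1
    ext i
    simp [hf]
    ring
  · have h1 : ∀ R : ℝ, (∑' c : Set.range f,
        volume (Metric.ball (c : EuclideanSpace ℝ (Fin d)) 1 ∩ cube d (-R) R)) /
          ENNReal.ofReal ((2 * R) ^ d) = ∑ x : X, (∑' z : Fin d → ℤ,
        volume (Metric.ball ((x : EuclideanSpace ℝ (Fin d)) + latticeVector L z) 1 ∩
          cube d (-R) R)) / ENNReal.ofReal ((2 * R) ^ d) := fun R => by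
      rw [← (Equiv.ofInjective f hinj).tsum_eq, ENNReal.tsum_prod', tsum_fintype]
      simp only [div_eq_mul_inv, Finset.sum_mul]
      rfl
    have h2 := tendsto_finsetSum (Finset.univ : Finset X) fun x _ =>
      tendsto_tsum_volume (x : EuclideanSpace ℝ (Fin d)) hL
    unfold HasDensity
    simp only [h1]
    simpa using h2
  · gcongr
    exact Finset.card_image_le.trans hS

theorem optimalCoveringDensity_eq :
    optimalCoveringDensity d = ENNReal.ofReal (coveringConstant d) * unitBallVolume d := by
  refine le_antisymm ?_ (le_sInf ?_)
  · have h1 := ENNReal.Tendsto.mul_const (b := unitBallVolume d)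
      (ENNReal.tendsto_ofReal (tendsto_coveringCount (d := d))) (Or.inr unitBallVolume_ne_top)
    refine ge_of_tendsto h1 ?_
    filter_upwards [self_mem_nhdsWithin] with r hr
    have hr : 0 < r := hr
    -- Period 1/r turns the unit-ball cover of the period cube into an r-cover of the unit cube,
    -- giving density at most r^d N(r) V_d.
    obtain ⟨C, D, hC, hD, hle⟩ := exists_periodic_cover (d := d) (inv_pos.2 hr)
    refine (show optimalCoveringDensity d ≤ D from sInf_le ⟨C, hC, hD⟩).trans (hle.trans_eq ?_)
    have := coveringCount_homothety (d := d) (a := 0) (b := 1) (v := 0) zero_le_one hr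
      (inv_pos.2 hr)
    rw [inv_mul_cancel₀ hr.ne', mul_zero, mul_one, add_zero, add_zero] at this
    rw [this, inv_inv, ENNReal.ofReal_mul (by positivity), ENNReal.ofReal_natCast]
    ring
  · rintro D ⟨C, hC, hD⟩
    exact le_of_hasDensity hC hD

/-! ### Polarization: existence of σ and its lower bound -/

section Polarization

variable {E : Type*} [MetricSpace E] {A : Set E}

lemma polarization_mono (hne : A.Nonempty) (s : ℝ) {N M : ℕ} (h : N ≤ M) :
    polarization s A N ≤ polarization s A M := by
  obtain ⟨a, ha⟩ := hne
  obtain ⟨m, rfl⟩ := Nat.exists_eq_add_of_le h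
  refine iSup_le fun x => le_iSup_of_le (Fin.append x fun _ => ⟨a, ha⟩) (iInf_mono fun y => ?_)
  rw [Fin.sum_univ_add]
  simp

lemma le_polarization_of_coveringCount_le (hA : IsCompact A) (hne : A.Nonempty) {s : ℝ}
    (hs : 0 ≤ s) {r : ℝ} (hr : 0 < r) {N : ℕ} (hN : coveringCount A r ≤ N) :
    ENNReal.ofReal (r ^ (-s)) ≤ polarization s A N := by
  obtain ⟨x, hx⟩ := exists_config hA hne hr hN
  refine le_iSup_of_le x (le_iInf fun y => ?_)
  obtain ⟨j, hj⟩ := hx y y.2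
  refine le_trans ?_ (Finset.single_le_sum (f := fun j => 1 / edist (y : E) (x j : E) ^ s)
    (fun _ _ => zero_le) (Finset.mem_univ j))
  rw [Real.rpow_neg hr.le, ENNReal.ofReal_inv_of_pos (by positivity), one_div,
    ENNReal.inv_le_inv, ← ENNReal.ofReal_rpow_of_pos hr, edist_dist]
  gcongr

end Polarization

lemma edist_homothety {c : ℝ} (hc : 0 ≤ c) (v : Fin d → ℝ) (x y : EuclideanSpace ℝ (Fin d)) :
    edist (homothety c v x) (homothety c v y) = ENNReal.ofReal c * edist x y := by
  rw [edist_dist, dist_homothety hc, ENNReal.ofReal_mul hc, edist_dist]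

lemma homothety_mem_cube {k : ℕ} (z : Fin d → Fin k) {x : EuclideanSpace ℝ (Fin d)}
    (hx : x ∈ cube d 0 1) :
    homothety (k : ℝ)⁻¹ (fun i => (k : ℝ)⁻¹ * z i) x ∈ cube d 0 1 := by
  intro i
  have hk : (0 : ℝ) < k := by exact_mod_cast (z i).pos
  have h1 : ((z i : ℕ) : ℝ) + 1 ≤ k := by exact_mod_cast (z i).2
  obtain ⟨h2, h3⟩ := hx i
  rw [homothety_apply, ← mul_add]
  refine ⟨by positivity, ?_⟩
  rw [inv_mul_le_one₀ hk]
  linarith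

/-- Put a shrunken copy of the configuration in each subcube and, at y, keep only the copy in a
subcube containing y; its distances shrink by k, so its terms grow by k^s. -/
lemma mul_polarization_le {s : ℝ} (hs : 0 < s) {k : ℕ} (hk : 0 < k) (N : ℕ) :
    ENNReal.ofReal ((k : ℝ) ^ s) * polarization s (cube d 0 1) N ≤
      polarization s (cube d 0 1) (k ^ d * N) := by
  have hk' : (0 : ℝ) < k := by exact_mod_cast hk
  let e : Fin (k ^ d * N) ≃ (Fin d → Fin k) × Fin N :=
    finProdFinEquiv.symm.trans (finFunctionFinEquiv.symm.prodCongr (Equiv.refl _))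
  rw [polarization, ENNReal.mul_iSup]
  refine iSup_le fun x => ?_
  let x' : (Fin d → Fin k) × Fin N → cube d 0 1 := fun p =>
    ⟨homothety (k : ℝ)⁻¹ (fun i => (k : ℝ)⁻¹ * p.1 i) (x p.2), homothety_mem_cube p.1 (x p.2).2⟩
  refine le_iSup_of_le (fun j => x' (e j)) (le_iInf fun y => ?_)
  obtain ⟨z, w, hw, hwy⟩ := exists_subcube hk y.2
  rw [e.sum_comp fun p => 1 / edist (y : EuclideanSpace ℝ (Fin d)) (x' p) ^ s,
    Fintype.sum_prod_type]
  refine le_trans ?_ (Finset.single_le_sum (f := fun z => ∑ j, 1 / edist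
    (y : EuclideanSpace ℝ (Fin d)) (x' (z, j)) ^ s) (fun _ _ => zero_le) (Finset.mem_univ z))
  refine (mul_le_mul_right (iInf_le _ ⟨w, hw⟩) _).trans ?_
  rw [Finset.mul_sum]
  refine Finset.sum_le_sum fun j _ => le_of_eq ?_
  rw [← hwy]
  simp only [x']
  have h0 : ENNReal.ofReal ((k : ℝ)⁻¹) ≠ 0 := by simpa using hk.ne'
  rw [edist_homothety (by positivity), ENNReal.mul_rpow_of_nonneg _ _ hs.le, one_div, one_div,
    ENNReal.mul_inv (Or.inl (by simp [ENNReal.rpow_eq_zero_iff, h0, hs.not_gt]))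
      (Or.inl (by finiteness)), ENNReal.ofReal_inv_of_pos hk', ENNReal.inv_rpow, inv_inv,
    ENNReal.ofReal_rpow_of_pos hk']

lemma natCast_rpow {N : ℕ} (hN : 0 < N) (p : ℝ) :
    (N : ℝ≥0∞) ^ p = ENNReal.ofReal ((N : ℝ) ^ p) := by
  rw [← ENNReal.ofReal_rpow_of_pos (by exact_mod_cast hN), ENNReal.ofReal_natCast]

variable (d) in
lemma polarization_zero (s : ℝ) : polarization s (cube d 0 1) 0 = 0 := by
  have : Nonempty (cube d 0 1) := (cube_nonempty zero_le_one).to_subtype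
  simp [polarization, configPolarization]

/-- A Fekete argument: compare N with k^d M ≤ N for k = ⌊(N/M)^(1/d)⌋. The rounding loss (k /
(N/M)^(1/d))^s tends to 1. -/
lemma tendsto_polarization_iSup (hd : d ≠ 0) {s : ℝ} (hs : 0 < s) :
    Tendsto (fun N : ℕ => polarization s (cube d 0 1) N / (N : ℝ≥0∞) ^ (s / (d : ℝ))) atTop
      (𝓝 (⨆ N : ℕ, polarization s (cube d 0 1) N / (N : ℝ≥0∞) ^ (s / (d : ℝ)))) := by
  have hd' : (0 : ℝ) < d := by exact_mod_cast Nat.pos_of_ne_zero hd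
  refine tendsto_order.2 ⟨fun c hc => ?_, fun c hc => Eventually.of_forall fun N =>
    (le_iSup (fun N : ℕ => polarization s (cube d 0 1) N / (N : ℝ≥0∞) ^ (s / (d : ℝ))) N).trans_lt
      hc⟩
  obtain ⟨M, hM⟩ := lt_iSup_iff.1 hc
  rcases Nat.eq_zero_or_pos M with rfl | hM0
  · simp [polarization_zero] at hM
  have hM' : (0 : ℝ) < M := by exact_mod_cast hM0
  have hu : Tendsto (fun N : ℕ => ((N : ℝ) / M) ^ (d : ℝ)⁻¹) atTop atTop :=
    (tendsto_rpow_atTop (by positivity)).comp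
      (tendsto_natCast_atTop_atTop.atTop_div_const hM')
  have h1 : Tendsto (fun N : ℕ => ENNReal.ofReal
      (((⌊((N : ℝ) / M) ^ (d : ℝ)⁻¹⌋₊ : ℝ) / ((N : ℝ) / M) ^ (d : ℝ)⁻¹) ^ s) *
        (polarization s (cube d 0 1) M / (M : ℝ≥0∞) ^ (s / (d : ℝ)))) atTop
      (𝓝 (ENNReal.ofReal (1 ^ s) *
        (polarization s (cube d 0 1) M / (M : ℝ≥0∞) ^ (s / (d : ℝ))))) :=
    ENNReal.Tendsto.mul_const (ENNReal.tendsto_ofReal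
      (((tendsto_nat_floor_div_atTop (R := ℝ)).comp hu).rpow_const (Or.inr hs.le)))
      (Or.inl (by simp))
  rw [Real.one_rpow, ENNReal.ofReal_one, one_mul] at h1
  filter_upwards [h1.eventually_const_lt hM, eventually_ge_atTop M] with N h2 hN
  refine h2.trans_le ?_
  have hN0 : 0 < N := hM0.trans_le hN
  have hN' : (0 : ℝ) < N := by exact_mod_cast hN0
  set u := ((N : ℝ) / M) ^ (d : ℝ)⁻¹ with hu_def
  have hu1 : 1 ≤ u := Real.one_le_rpow ((one_le_div hM').2 (by exact_mod_cast hN)) (by positivity)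
  have hk : 0 < ⌊u⌋₊ := Nat.floor_pos.2 hu1
  have hu0 : 0 < u := by linarith
  have hud : u ^ d = N / M := Real.rpow_inv_natCast_pow (by positivity) hd
  have hkN : ⌊u⌋₊ ^ d * M ≤ N := by
    have : (⌊u⌋₊ : ℝ) ^ d * M ≤ N := by
      rw [← le_div_iff₀ hM', ← hud]
      gcongr
      exact Nat.floor_le hu0.le
    exact_mod_cast this
  have hus : u ^ s * (M : ℝ) ^ (s / d) = (N : ℝ) ^ (s / d) := by
    rw [hu_def, ← Real.rpow_mul (by positivity), inv_mul_eq_div,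
      ← Real.mul_rpow (by positivity) (by positivity), div_mul_cancel₀ _ hM'.ne']
  calc _ = ENNReal.ofReal ((⌊u⌋₊ : ℝ) ^ s) * polarization s (cube d 0 1) M /
        (N : ℝ≥0∞) ^ (s / (d : ℝ)) := by
        rw [natCast_rpow hM0, natCast_rpow hN0, ← hus, Real.div_rpow (by positivity) hu0.le,
          ENNReal.ofReal_div_of_pos (by positivity), ENNReal.ofReal_mul (by positivity)]
        simp only [div_eq_mul_inv]
        rw [ENNReal.mul_inv (Or.inr (by finiteness)) (Or.inl (by finiteness))]
        ring
    _ ≤ polarization s (cube d 0 1) N / (N : ℝ≥0∞) ^ (s / (d : ℝ)) := by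
        gcongr
        exact (mul_polarization_le hs hk M).trans
          (polarization_mono (cube_nonempty zero_le_one) s hkN)

lemma sigma_eq_iSup (hd : d ≠ 0) {s : ℝ} (hs : 0 < s) :
    sigma s d = ⨆ N : ℕ, polarization s (cube d 0 1) N / (N : ℝ≥0∞) ^ (s / (d : ℝ)) :=
  (tendsto_polarization_iSup hd hs).limUnder_eq

lemma le_sigma (hd : d ≠ 0) {s : ℝ} (hs : 0 < s) {r : ℝ} (hr : 0 < r) :
    ENNReal.ofReal ((r ^ d * (coveringCount (cube d 0 1) r : ℝ)) ^ (-(s / d))) ≤ sigma s d := by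
  have hd' : (0 : ℝ) < d := by exact_mod_cast Nat.pos_of_ne_zero hd
  have hA := isCompact_cube (d := d) 0 1
  have hne := cube_nonempty (d := d) zero_le_one
  have hn := coveringCount_pos hA hne hr
  have hn' : (0 : ℝ) < coveringCount (cube d 0 1) r := by exact_mod_cast hn
  rw [sigma_eq_iSup hd hs]
  refine le_iSup_of_le (coveringCount (cube d 0 1) r) ?_
  refine le_trans (le_of_eq ?_) (ENNReal.div_le_div_right
    (le_polarization_of_coveringCount_le hA hne hs.le hr le_rfl) _)
  rw [natCast_rpow hn, ← ENNReal.ofReal_div_of_pos (by positivity),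
    Real.mul_rpow (by positivity) (by positivity), ← Real.rpow_natCast, ← Real.rpow_mul hr.le,
    Real.rpow_neg hn'.le, div_eq_mul_inv]
  congr 3
  field_simp

/-! ### Upper bound for polarization -/

/-- The integrable kernel `(1 + |y| / r)^{-t}`, for `t > d`. -/
noncomputable def kernel (t r : ℝ) (y : EuclideanSpace ℝ (Fin d)) : ℝ≥0∞ :=
  ENNReal.ofReal ((1 + ‖y‖ / r) ^ (-t))

lemma measurable_kernel (t r : ℝ) : Measurable (kernel (d := d) t r) := by
  unfold kernel
  fun_prop

variable (d) in
/-- The integral of the kernel at unit scale. -/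
noncomputable def kernelMass (t : ℝ) : ℝ≥0∞ :=
  ∫⁻ y : EuclideanSpace ℝ (Fin d), ENNReal.ofReal ((1 + ‖y‖) ^ (-t))

lemma kernelMass_lt_top {t : ℝ} (ht : d < t) : kernelMass d t < ⊤ :=
  finite_integral_one_add_norm (by simpa using ht)

lemma lintegral_kernel (t : ℝ) {r : ℝ} (hr : 0 < r) :
    ∫⁻ y : EuclideanSpace ℝ (Fin d), kernel t r y = ENNReal.ofReal (r ^ d) * kernelMass d t := by
  have h1 : (fun y : EuclideanSpace ℝ (Fin d) => kernel t r y) =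
      fun y => ENNReal.ofReal ((1 + ‖r⁻¹ • y‖) ^ (-t)) := by
    funext y
    rw [kernel, norm_smul, Real.norm_of_nonneg (by positivity), div_eq_inv_mul]
  rw [h1, ← lintegral_map (f := fun y : EuclideanSpace ℝ (Fin d) =>
    ENNReal.ofReal ((1 + ‖y‖) ^ (-t))) (by fun_prop) (by fun_prop),
    Measure.map_addHaar_smul volume (inv_ne_zero hr.ne'), lintegral_smul_measure, kernelMass]
  rw [finrank_euclideanSpace_fin, inv_pow, inv_inv, abs_of_pos (by positivity), smul_eq_mul]

/-- A Harnack-type inequality: moving by at most r at most doubles 1 + |·|/r. -/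
lemma kernel_le {t r : ℝ} (ht : 0 ≤ t) (hr : 0 < r) {x y : EuclideanSpace ℝ (Fin d)}
    (h : dist x y ≤ r) : ENNReal.ofReal (2 ^ (-t)) * kernel t r x ≤ kernel t r y := by
  rw [kernel, kernel, ← ENNReal.ofReal_mul (by positivity),
    ← Real.mul_rpow (by positivity) (by positivity)]
  refine ENNReal.ofReal_le_ofReal
    (Real.rpow_le_rpow_of_nonpos (by positivity) ?_ (by linarith))
  have h1 : ‖y‖ ≤ ‖x‖ + r := by
    have := norm_le_norm_add_norm_sub x y
    rw [← dist_eq_norm] at this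
    linarith
  have h2 : ‖y‖ / r ≤ ‖x‖ / r + 1 := by
    rw [div_add_one hr.ne']
    gcongr
  have : 0 ≤ ‖x‖ / r := by positivity
  linarith

/-- The smoothed counting function of a configuration. -/
noncomputable def crowding (t r : ℝ) {N : ℕ} (x : Fin N → EuclideanSpace ℝ (Fin d))
    (y : EuclideanSpace ℝ (Fin d)) : ℝ≥0∞ :=
  ∑ j, kernel t r (y - x j)

lemma lintegral_crowding (t : ℝ) {r : ℝ} (hr : 0 < r) {N : ℕ}
    (x : Fin N → EuclideanSpace ℝ (Fin d)) :
    ∫⁻ y, crowding t r x y = N * (ENNReal.ofReal (r ^ d) * kernelMass d t) := by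
  simp only [crowding]
  rw [lintegral_finsetSum (f := fun j y => kernel t r (y - x j)) _ fun j _ =>
    (measurable_kernel t r).comp (measurable_sub_const _)]
  simp only [lintegral_sub_right_eq_self (kernel t r), lintegral_kernel t hr]
  simp

lemma crowding_le {t r : ℝ} (ht : 0 ≤ t) (hr : 0 < r) {N : ℕ}
    (x : Fin N → EuclideanSpace ℝ (Fin d)) {y z : EuclideanSpace ℝ (Fin d)} (h : dist y z ≤ r) :
    ENNReal.ofReal (2 ^ (-t)) * crowding t r x y ≤ crowding t r x z := by
  rw [crowding, Finset.mul_sum]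
  exact Finset.sum_le_sum fun j _ => kernel_le ht hr (by simpa using h)

/-- A separated set of points at which a configuration is crowded is small. -/
lemma card_mul_le_of_crowded {t r : ℝ} (ht : 0 ≤ t) (hr : 0 < r) {N : ℕ}
    (x : Fin N → EuclideanSpace ℝ (Fin d)) {T : Finset (EuclideanSpace ℝ (Fin d))}
    (hsep : (T : Set (EuclideanSpace ℝ (Fin d))).Pairwise fun y z => r ≤ dist y z) {Λ : ℝ≥0∞}
    (hΛ : ∀ y ∈ T, Λ ≤ crowding t r x y) :
    T.card * (ENNReal.ofReal (2 ^ (-t)) * Λ * (ENNReal.ofReal ((r / 2) ^ d) * unitBallVolume d)) ≤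
      N * (ENNReal.ofReal (r ^ d) * kernelMass d t) := by
  rw [← lintegral_crowding t hr x]
  have hdisj : (T : Set (EuclideanSpace ℝ (Fin d))).PairwiseDisjoint
      fun y => Metric.ball y (r / 2) := fun y hy z hz hyz =>
    Metric.ball_disjoint_ball (by linarith [hsep hy hz hyz])
  calc _ = ∑ y ∈ T, ∫⁻ z in Metric.ball y (r / 2), ENNReal.ofReal (2 ^ (-t)) * Λ := by
        simp only [setLIntegral_const, Measure.addHaar_ball_of_pos volume _ (half_pos hr)]
        simp [unitBallVolume_eq]
    _ ≤ ∑ y ∈ T, ∫⁻ z in Metric.ball y (r / 2), crowding t r x z := by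
        refine Finset.sum_le_sum fun y hy => setLIntegral_mono' measurableSet_ball fun z hz => ?_
        refine (mul_le_mul_right (hΛ y hy) _).trans (crowding_le ht hr x ?_)
        rw [dist_comm]
        linarith [Metric.mem_ball.1 hz]
    _ = ∫⁻ z in ⋃ y ∈ T, Metric.ball y (r / 2), crowding t r x z :=
        (lintegral_biUnion_finset hdisj (fun _ _ => measurableSet_ball) _).symm
    _ ≤ _ := setLIntegral_le_lintegral _ _

lemma exists_crowding_bound {t : ℝ} (ht : d < t) {δ : ℝ} (hδ : 0 < δ) :
    ∃ K : ℝ, 0 < K ∧ ∀ (N : ℕ) (x : Fin N → EuclideanSpace ℝ (Fin d)) (r : ℝ), 0 < r →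
      ∀ T : Finset (EuclideanSpace ℝ (Fin d)),
        (T : Set (EuclideanSpace ℝ (Fin d))).Pairwise (fun y z => r ≤ dist y z) →
        (∀ y ∈ T, ENNReal.ofReal K ≤ crowding t r x y) → (T.card : ℝ) ≤ δ * N := by
  have ht0 : 0 ≤ t := (Nat.cast_nonneg d).trans ht.le
  set I := (kernelMass d t).toReal with hI
  set V := (unitBallVolume d).toReal with hV
  have hI0 : 0 ≤ I := ENNReal.toReal_nonneg
  have hV0 : 0 < V := ENNReal.toReal_pos unitBallVolume_ne_zero unitBallVolume_ne_top
  have h2t : (0 : ℝ) < 2 ^ (-t) := by positivity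
  -- Total mass is N r^d I, and each crowded point claims at least a multiple of K r^d on its own
  -- r/2-ball; r cancels. Using I + 1 makes K visibly positive.
  refine ⟨(I + 1) * 2 ^ d / (2 ^ (-t) * V * δ), by positivity, fun N x r hr T hsep hT => ?_⟩
  have h := ENNReal.toReal_mono (by
    have := (kernelMass_lt_top ht).ne
    finiteness) (card_mul_le_of_crowded ht0 hr x hsep hT)
  simp only [ENNReal.toReal_mul, ENNReal.toReal_natCast] at h
  rw [ENNReal.toReal_ofReal h2t.le, ENNReal.toReal_ofReal (by positivity),
    ENNReal.toReal_ofReal (by positivity), ENNReal.toReal_ofReal (by positivity), ← hI, ← hV] at h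
  have e : (T.card : ℝ) * (2 ^ (-t) * ((I + 1) * 2 ^ d / (2 ^ (-t) * V * δ)) * ((r / 2) ^ d * V)) =
      (T.card / δ) * ((I + 1) * r ^ d) := by
    rw [div_pow]
    field_simp
  rw [e] at h
  have h2 : (T.card / δ) * ((I + 1) * r ^ d) ≤ N * ((I + 1) * r ^ d) := by
    refine h.trans ?_
    rw [mul_comm (r ^ d)]
    gcongr
    linarith
  have h3 := le_of_mul_le_mul_right h2 (by positivity)
  rwa [div_le_iff₀ hδ, mul_comm] at h3

/-- A point of the cube far from a configuration near which the configuration is not crowded. -/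
lemma exists_uncrowded_point {t : ℝ} (ht : d < t) {δ : ℝ} (hδ : 0 < δ) :
    ∃ K : ℝ, 0 < K ∧ ∀ (N : ℕ) (x : Fin N → EuclideanSpace ℝ (Fin d)) (r : ℝ), 0 < r →
      r ^ d * ((1 + δ) * N) < coveringConstant d →
      ∃ y ∈ cube d 0 1, (∀ j, r ≤ dist y (x j)) ∧ crowding t r x y ≤ ENNReal.ofReal K := by
  classical
  obtain ⟨K, hK, hcard⟩ := exists_crowding_bound ht hδ
  refine ⟨K, hK, fun N x r hr hlt => ?_⟩
  by_contra! hcon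
  -- Greedy selection: separated crowded sets have at most δN points, so one that cannot be enlarged
  -- exists, and its r-balls cover every crowded point.
  obtain ⟨T, hTc, hT⟩ : ∃ T : Finset (EuclideanSpace ℝ (Fin d)), (T.card : ℝ) ≤ δ * N ∧
      ∀ y, ENNReal.ofReal K ≤ crowding t r x y → ∃ z ∈ T, dist y z < r := by
    by_contra! hno
    have key : ∀ n : ℕ, ∃ T : Finset (EuclideanSpace ℝ (Fin d)), T.card = n ∧
        (T : Set (EuclideanSpace ℝ (Fin d))).Pairwise (fun y z => r ≤ dist y z) ∧
        ∀ y ∈ T, ENNReal.ofReal K ≤ crowding t r x y := by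
      intro n
      induction n with
      | zero => exact ⟨∅, by simp⟩
      | succ n ih =>
        obtain ⟨T, hn, hsep, hT⟩ := ih
        obtain ⟨y, hy, hyT⟩ := hno T (hcard N x r hr T hsep hT)
        have hyn : y ∉ T := fun h => by simpa using hr.trans_le (hyT y h)
        refine ⟨insert y T, by rw [Finset.card_insert_of_notMem hyn, hn], ?_, ?_⟩
        · rw [Finset.coe_insert]
          exact hsep.insert fun z hz _ => ⟨hyT z hz, by rw [dist_comm]; exact hyT z hz⟩
        · simpa [hy] using hT
    obtain ⟨n, hn⟩ := exists_nat_gt (δ * N)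
    obtain ⟨T, rfl, hsep, hT⟩ := key n
    exact hn.not_ge (hcard N x r hr T hsep hT)
  have hcov : coveringCount (cube d 0 1) r ≤ (T ∪ Finset.univ.image x).card := by
    refine coveringCount_le_card zero_le_one _ fun y hy => ?_
    by_cases h : ∀ j, r ≤ dist y (x j)
    · obtain ⟨z, hz, hyz⟩ := hT y (hcon y hy h).le
      exact ⟨z, Finset.mem_union_left _ hz, hyz⟩
    · push Not at h
      obtain ⟨j, hj⟩ := h
      exact ⟨x j, Finset.mem_union_right _ (Finset.mem_image_of_mem _ (Finset.mem_univ j)), hj⟩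
  have hc : (T ∪ Finset.univ.image x).card ≤ T.card + N :=
    (Finset.card_union_le _ _).trans (by gcongr; exact Finset.card_image_le.trans (by simp))
  have hc' : (coveringCount (cube d 0 1) r : ℝ) ≤ T.card + N := by exact_mod_cast hcov.trans hc
  refine hlt.not_ge ((coveringConstant_le hr).trans ?_)
  gcongr
  linarith

/-- Beyond distance r the exponent s may be lowered to t at scale r, so s survives only in r^(-s).
The factor 2^t comes from 1 + u ≤ 2u for u ≥ 1. -/
lemma one_div_edist_rpow_le {s t r : ℝ} (ht : 0 ≤ t) (hst : t ≤ s) (hr : 0 < r)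
    {x y : EuclideanSpace ℝ (Fin d)} (h : r ≤ dist y x) :
    1 / edist y x ^ s ≤ ENNReal.ofReal (r ^ (-s) * 2 ^ t) * kernel t r (y - x) := by
  have hρ : 0 < dist y x := hr.trans_le h
  rw [kernel, ← dist_eq_norm, edist_dist, ENNReal.ofReal_rpow_of_pos hρ, one_div,
    ← ENNReal.ofReal_inv_of_pos (by positivity), ← Real.rpow_neg hρ.le,
    ← ENNReal.ofReal_mul (by positivity)]
  refine ENNReal.ofReal_le_ofReal ?_
  set u := dist y x / r with hu
  have hu1 : 1 ≤ u := (one_le_div hr).2 h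
  have e : dist y x = r * u := by rw [hu]; field_simp
  rw [e, Real.mul_rpow hr.le (by positivity), mul_assoc]
  gcongr
  calc u ^ (-s) ≤ u ^ (-t) := Real.rpow_le_rpow_of_exponent_le hu1 (by linarith)
    _ = 2 ^ t * (2 * u) ^ (-t) := by
        rw [Real.mul_rpow zero_le_two (by positivity), ← mul_assoc, ← Real.rpow_add two_pos]
        simp
    _ ≤ 2 ^ t * (1 + u) ^ (-t) := by
        gcongr ?_ * ?_
        exact Real.rpow_le_rpow_of_nonpos (by positivity) (by linarith) (by linarith)

lemma exists_polarization_le (hd : d ≠ 0) {t : ℝ} (ht : d < t) {q : ℝ} (hq : 0 < q)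
    (hqθ : q < coveringConstant d) :
    ∃ K : ℝ, 0 < K ∧ ∀ s : ℝ, t ≤ s → ∀ N : ℕ, 0 < N →
      polarization s (cube d 0 1) N / (N : ℝ≥0∞) ^ (s / (d : ℝ)) ≤
        ENNReal.ofReal (K * q ^ (-(s / d))) := by
  have ht0 : 0 ≤ t := (Nat.cast_nonneg d).trans ht.le
  obtain ⟨q', hqq', hq'⟩ := exists_between hqθ
  -- This δ makes r^d (1 + δ) N equal to q' < θ when r^d = q/N.
  obtain ⟨K, hK, hgood⟩ := exists_uncrowded_point ht (δ := q' / q - 1)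
    (by rw [sub_pos]; exact (one_lt_div hq).2 hqq')
  refine ⟨2 ^ t * K, by positivity, fun s hs N hN => ?_⟩
  have hN' : (0 : ℝ) < N := by exact_mod_cast hN
  set r := (q / N) ^ (d : ℝ)⁻¹ with hr_def
  have hr : 0 < r := by positivity
  have hrd : r ^ d = q / N := Real.rpow_inv_natCast_pow (by positivity) hd
  have hrs : r ^ (-s) / (N : ℝ) ^ (s / d) = q ^ (-(s / d)) := by
    rw [hr_def, ← Real.rpow_mul (by positivity), show (d : ℝ)⁻¹ * -s = -(s / d) by ring,
      Real.div_rpow hq.le hN'.le, Real.rpow_neg hN'.le]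
    field_simp
  have hP : polarization s (cube d 0 1) N ≤ ENNReal.ofReal (r ^ (-s) * 2 ^ t * K) := by
    refine iSup_le fun x => ?_
    obtain ⟨y, hy, hfar, hc⟩ := hgood N (fun j => x j) r hr (by
      rw [hrd]
      convert hq' using 1
      field_simp
      ring)
    refine (iInf_le _ ⟨y, hy⟩).trans ?_
    calc _ ≤ ∑ j, ENNReal.ofReal (r ^ (-s) * 2 ^ t) *
          kernel t r (y - (x j : EuclideanSpace ℝ (Fin d))) :=
          Finset.sum_le_sum fun j _ => one_div_edist_rpow_le ht0 hs hr (hfar j)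
      _ = ENNReal.ofReal (r ^ (-s) * 2 ^ t) * crowding t r (fun j => x j) y := by
          rw [crowding, Finset.mul_sum]
      _ ≤ _ := by
          rw [ENNReal.ofReal_mul (q := K) (by positivity)]
          gcongr
  refine (ENNReal.div_le_div_right hP _).trans (le_of_eq ?_)
  rw [natCast_rpow hN, ← ENNReal.ofReal_div_of_pos (by positivity), ← hrs]
  congr 1
  ring

/-! ### Bounds on σ and the limit s → ∞ -/

lemma exists_sigma_le (hd : d ≠ 0) {t : ℝ} (ht : d < t) {q : ℝ} (hq : 0 < q)
    (hqθ : q < coveringConstant d) :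
    ∃ K : ℝ, 0 < K ∧ ∀ s : ℝ, t ≤ s → sigma s d ≤ ENNReal.ofReal (K * q ^ (-(s / d))) := by
  obtain ⟨K, hK, h⟩ := exists_polarization_le hd ht hq hqθ
  refine ⟨K, hK, fun s hs => ?_⟩
  rw [sigma_eq_iSup hd ((Nat.cast_nonneg d).trans_lt (ht.trans_le hs))]
  refine iSup_le fun N => ?_
  rcases Nat.eq_zero_or_pos N with rfl | hN
  · simp [polarization_zero]
  · exact h s hs N hN

lemma sigma_lt_top (hd : d ≠ 0) {s : ℝ} (hs : d < s) : sigma s d < ⊤ := by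
  obtain ⟨K, -, h⟩ := exists_sigma_le hd hs (half_pos coveringConstant_pos)
    (half_lt_self coveringConstant_pos)
  exact (h s le_rfl).trans_lt ENNReal.ofReal_lt_top

lemma sigma_pos (hd : d ≠ 0) {s : ℝ} (hs : 0 < s) : 0 < sigma s d := by
  refine lt_of_lt_of_le (ENNReal.ofReal_pos.2 (Real.rpow_pos_of_pos ?_ _))
    (le_sigma hd hs one_pos)
  exact coveringConstant_pos.trans_le (coveringConstant_le one_pos)

lemma sigma_rpow_le (hd : d ≠ 0) {s : ℝ} (hs : d < s) :
    (sigma s d).toReal ^ (-(d : ℝ) / s) ≤ coveringConstant d := by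
  have hd' : (0 : ℝ) < d := by exact_mod_cast Nat.pos_of_ne_zero hd
  have hs0 : 0 < s := hd'.trans hs
  refine le_csInf (Set.nonempty_Ioi.image _) ?_
  rintro _ ⟨r, hr, rfl⟩
  have hr : 0 < r := hr
  have hpos := coveringConstant_pos.trans_le (coveringConstant_le (d := d) hr)
  have h := ENNReal.toReal_mono (sigma_lt_top hd hs).ne (le_sigma hd hs0 hr)
  rw [ENNReal.toReal_ofReal (by positivity)] at h
  refine (Real.rpow_le_rpow_of_nonpos (by positivity) h
    (by rw [neg_div]; exact neg_nonpos.2 (by positivity))).trans (le_of_eq ?_)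
  rw [← Real.rpow_mul hpos.le, show -(s / d) * (-(d : ℝ) / s) = 1 by field_simp, Real.rpow_one]

lemma tendsto_sigma_rpow (hd : d ≠ 0) :
    Tendsto (fun s : ℝ => (sigma s d).toReal ^ (-(d : ℝ) / s)) atTop
      (𝓝 (coveringConstant d)) := by
  have hd' : (0 : ℝ) < d := by exact_mod_cast Nat.pos_of_ne_zero hd
  refine tendsto_order.2 ⟨fun c hc => ?_, fun c hc => ?_⟩
  · obtain ⟨q, hq, hqθ⟩ := exists_between (max_lt hc coveringConstant_pos)
    obtain ⟨hcq, hq0⟩ := max_lt_iff.1 hq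
    obtain ⟨K, hK, h⟩ := exists_sigma_le hd (lt_add_one (d : ℝ)) hq0 hqθ
    have h1 : Tendsto (fun s : ℝ => K ^ (-(d : ℝ) / s) * q) atTop (𝓝 (K ^ (0 : ℝ) * q)) :=
      (tendsto_const_nhds.rpow (tendsto_const_nhds.div_atTop tendsto_id)
        (Or.inl hK.ne')).mul_const q
    rw [Real.rpow_zero, one_mul] at h1
    filter_upwards [h1.eventually_const_lt hcq, eventually_ge_atTop ((d : ℝ) + 1)] with s h2 hs
    have hs0 : 0 < s := by linarith
    refine h2.trans_le ?_
    have h3 := ENNReal.toReal_mono ENNReal.ofReal_ne_top (h s hs)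
    rw [ENNReal.toReal_ofReal (by positivity)] at h3
    refine le_trans (le_of_eq ?_) (Real.rpow_le_rpow_of_nonpos (ENNReal.toReal_pos
      (sigma_pos hd hs0).ne' (sigma_lt_top hd (by linarith)).ne) h3
      (by rw [neg_div]; exact neg_nonpos.2 (by positivity)))
    rw [Real.mul_rpow hK.le (by positivity), ← Real.rpow_mul hq0.le,
      show -(s / d) * (-(d : ℝ) / s) = 1 by field_simp, Real.rpow_one]
  · filter_upwards [eventually_gt_atTop (d : ℝ)] with s hs
    exact (sigma_rpow_le hd hs).trans_lt hc

lemma optimalCoveringDensity_div :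
    (optimalCoveringDensity d / unitBallVolume d).toReal = coveringConstant d := by
  rw [optimalCoveringDensity_eq,
    ENNReal.mul_div_cancel_right unitBallVolume_ne_zero unitBallVolume_ne_top,
    ENNReal.toReal_ofReal coveringConstant_pos.le]

end RieszCovering

theorem mainTheorem8 (d : ℕ) (hd : 1 ≤ d) :
    -- `Γ_d` is positive and finite
    (0 < RieszCovering.optimalCoveringDensity d ∧ RieszCovering.optimalCoveringDensity d < ⊤) ∧
    -- for `s > d` the limit defining `σ_{s,d}` exists, and it is positive and finite
    (∀ s : ℝ, (d : ℝ) < s →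
      Tendsto
        (fun N : ℕ => RieszCovering.polarization s (RieszCovering.cube d 0 1) N /
          (N : ℝ≥0∞) ^ (s / (d : ℝ)))
        atTop (𝓝 (RieszCovering.sigma s d)) ∧
      0 < RieszCovering.sigma s d ∧ RieszCovering.sigma s d < ⊤) ∧
    Tendsto
      (fun R : ℝ => (RieszCovering.coveringCount (RieszCovering.cube d (-R) R) 1 : ℝ) / (2 * R) ^ d)
      atTop
      (𝓝 (RieszCovering.optimalCoveringDensity d / RieszCovering.unitBallVolume d).toReal) ∧
    Tendsto
      (fun r : ℝ => r ^ d * (RieszCovering.coveringCount (RieszCovering.cube d 0 1) r : ℝ))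
      (𝓝[>] 0)
      (𝓝 (RieszCovering.optimalCoveringDensity d / RieszCovering.unitBallVolume d).toReal) ∧
    Tendsto
      (fun N : ℕ => (N : ℝ) * RieszCovering.coveringRadius (RieszCovering.cube d 0 1) N ^ d)
      atTop
      (𝓝 (RieszCovering.optimalCoveringDensity d / RieszCovering.unitBallVolume d).toReal) ∧
    Tendsto
      (fun s : ℝ => (RieszCovering.sigma s d).toReal ^ (-(d : ℝ) / s))
      atTop
      (𝓝 (RieszCovering.optimalCoveringDensity d / RieszCovering.unitBallVolume d).toReal) := by
  have hd0 : d ≠ 0 := Nat.one_le_iff_ne_zero.1 hd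
  have hs0 : ∀ {s : ℝ}, (d : ℝ) < s → 0 < s := fun hs => (Nat.cast_nonneg d).trans_lt hs
  rw [RieszCovering.optimalCoveringDensity_div]
  refine ⟨⟨?_, ?_⟩, fun s hs => ⟨?_, RieszCovering.sigma_pos hd0 (hs0 hs),
    RieszCovering.sigma_lt_top hd0 hs⟩, RieszCovering.tendsto_coveringCount_cube,
    RieszCovering.tendsto_coveringCount, RieszCovering.tendsto_coveringRadius hd0,
    RieszCovering.tendsto_sigma_rpow hd0⟩
  · rw [RieszCovering.optimalCoveringDensity_eq]
    exact ENNReal.mul_pos (ENNReal.ofReal_pos.2 RieszCovering.coveringConstant_pos).ne'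
      RieszCovering.unitBallVolume_ne_zero
  · rw [RieszCovering.optimalCoveringDensity_eq]
    exact ENNReal.mul_lt_top ENNReal.ofReal_lt_top
      (lt_top_iff_ne_top.2 RieszCovering.unitBallVolume_ne_top)
  · rw [RieszCovering.sigma_eq_iSup hd0 (hs0 hs)]
    exact RieszCovering.tendsto_polarization_iSup hd0 (hs0 hs)
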